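/- For a complex square matrix $X$ and a real number $p\ge 1$, let $\|X\|_p=\big(\sum_j \sigma_j(X)^p\big)^{1/p}$ be the Schatten $p$-norm, where the $\sigma_j(X)$ are the singular values of $X$, and let $$w_p(X)=\sup_{\theta\in\mathbb{R}}\big\|\mathrm{Re}(e^{i\theta}X)\big\|_p,\qquad \mathrm{Re}(Y)=\tfrac12(Y+Y^*),$$ be the corresponding generalized numerical radius; write $w_p^p(X)$ for $(w_p(X))^p$. Let $p\in[2,\infty)$ and let $A,B,D\in M_n(\mathbb{C})$. Then: 1. $$w_p\left(\begin{bmatrix}A&0\\0&D\end{bmatrix}\right)\le \frac{1}{2^{\frac2p-1}}\Big(w_p^p(A)+w_p^p(D)\Big)^{\frac1p},$$ and, if $A$ and $D$ are Hermitian, $$w_p\left(\begin{bmatrix}A&0\\0&D\end{bmatrix}\right)=\Big(w_p^p(A)+w_p^p(D)\Big)^{\frac1p}.$$ 2. $$w_p\left(\begin{bmatrix}A&B\\0&0\end{bmatrix}\right)\le \frac{1}{2^{\frac2p-1}}\Big(w_p^p(A)+\frac{1}{2^{p-1}}\|B\|_p^p\Big)^{\frac1p}.$$ -/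

import Mathlib

/-- The Schatten `p`-norm `‖A‖_p = (∑ⱼ σⱼ(A) ^ p) ^ (1 / p)` of a square complex matrix, where
`σ₀(A) ≥ σ₁(A) ≥ …` are the singular values of `A` (as an operator on the Euclidean space). -/
noncomputable def schattenNorm {m : Type*} [Fintype m] [DecidableEq m] (p : ℝ)
    (A : Matrix m m ℂ) : ℝ :=
  (∑ j ∈ Finset.range (Fintype.card m),
    (Matrix.toEuclideanLin A).singularValues j ^ p) ^ (1 / p)

/-- The real part `Re(e^{iθ} A)` of a rotation of `A`, where `Re X = (X + X*) / 2`. -/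
noncomputable def rotatedRealPart {m : Type*} [Fintype m] [DecidableEq m]
    (A : Matrix m m ℂ) (θ : ℝ) : Matrix m m ℂ :=
  (1 / 2 : ℂ) • (Complex.exp (θ * Complex.I) • A +
    (Complex.exp (θ * Complex.I) • A).conjTranspose)

/-- The generalized numerical radius `w_p(A) = sup_θ ‖Re(e^{iθ} A)‖_p` for the Schatten `p`-norm. -/
noncomputable def schattenNumericalRadius {m : Type*} [Fintype m] [DecidableEq m] (p : ℝ)
    (A : Matrix m m ℂ) : ℝ :=
  ⨆ θ : ℝ, schattenNorm p (rotatedRealPart A θ)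

open scoped Matrix.Norms.L2Operator in
/-- Every singular value is at most the operator norm. -/
theorem singularValues_le_l2_opNorm {m : Type*} [Fintype m] [DecidableEq m] (A : Matrix m m ℂ) (j : ℕ) :
   (Matrix.toEuclideanLin A).singularValues j ≤ ‖A‖ := by
  by_cases hj : j < Module.finrank ℂ (EuclideanSpace ℂ m)
  · have h := (Matrix.toEuclideanLin A).hasEigenvalue_adjoint_comp_self_sq_singularValues hj
    obtain ⟨v, hv⟩ := h.exists_hasEigenvector
    have h1 := hv.apply_eq_smul
    have h2 : ‖Matrix.toEuclideanLin A v‖ ^ 2 = ((Matrix.toEuclideanLin A).singularValues j * ‖v‖) ^ 2 := by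
      have := congrArg (fun w => RCLike.re (inner ℂ v w)) h1
      simp only [LinearMap.comp_apply, LinearMap.adjoint_inner_right, inner_smul_right, inner_self_eq_norm_sq_to_K] at this
      norm_cast at this
      rw [mul_pow, ← this]
    have h3 : ‖Matrix.toEuclideanLin A v‖ = (Matrix.toEuclideanLin A).singularValues j * ‖v‖ :=
      (sq_eq_sq₀ (norm_nonneg _) (mul_nonneg (LinearMap.singularValues_nonneg _ _) (norm_nonneg _))).1 h2
    have h4 : ‖Matrix.toEuclideanLin A v‖ ≤ ‖A‖ * ‖v‖ := A.l2_opNorm_mulVec v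
    have := norm_pos_iff.2 hv.2
    exact le_of_mul_le_mul_right (h3 ▸ h4) this
  · rw [LinearMap.singularValues_of_finrank_le _ (not_lt.1 hj)]; positivity

open scoped Matrix.Norms.L2Operator in
/-- The supremum defining `w_p` is over a bounded set, so it is a genuine real supremum. -/
theorem bddAbove_schattenNorm_rotatedRealPart {m : Type*} [Fintype m] [DecidableEq m] (p : ℝ) (hp : 0 < p) (A : Matrix m m ℂ) :
    BddAbove (Set.range fun θ : ℝ => schattenNorm p (rotatedRealPart A θ)) := by
  refine ⟨(∑ j ∈ Finset.range (Fintype.card m), ‖A‖ ^ p) ^ (1 / p), ?_⟩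
  rintro _ ⟨θ, rfl⟩
  have hn : ‖rotatedRealPart A θ‖ ≤ ‖A‖ := by
    unfold rotatedRealPart
    rw [norm_smul]
    have := norm_add_le (Complex.exp (θ * Complex.I) • A) (Complex.exp (θ * Complex.I) • A).conjTranspose
    rw [Matrix.l2_opNorm_conjTranspose, norm_smul, Complex.norm_exp_ofReal_mul_I] at this
    rw [show ‖(1/2:ℂ)‖ = 1/2 by norm_num]
    linarith
  unfold schattenNorm
  have h0 := fun j => LinearMap.singularValues_nonneg (Matrix.toEuclideanLin (rotatedRealPart A θ)) j
  apply Real.rpow_le_rpow (Finset.sum_nonneg fun j _ => Real.rpow_nonneg (h0 j) _)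
  · exact Finset.sum_le_sum fun j _ => Real.rpow_le_rpow (h0 j) ((singularValues_le_l2_opNorm _ j).trans hn) hp.le
  · positivity

open Matrix
open scoped ComplexOrder

/-! Everything passes to p-th powers: `‖X‖_p^p = tr (X*X)^(p/2)`, read off the roots of the
characteristic polynomial, so that cyclic invariance and additivity over diagonal blocks are facts
about polynomials. Block-diagonal matrices then satisfy the first bound even with constant 1. For
the row, `Re(e^{iθ}X)` has blocks `H, K, K*, 0`, and `schattenNorm_fromBlocks_rpow_le` bounds it by
using `tr (S+T)^q ≤ 2^(q-1) (tr S^q + tr T^q)` twice with `q = p/2`, whence the factor `2^(p-2)`. -/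

/-- The sum of the `q`-th powers of the (real parts of the) eigenvalues of a matrix. -/
noncomputable def eigPowSum {m : Type*} [Fintype m] [DecidableEq m] (q : ℝ)
    (A : Matrix m m ℂ) : ℝ :=
  (A.charpoly.roots.map fun z => z.re ^ q).sum

/-! ### Traces of powers of positive semidefinite matrices. -/

section EigPowSum

variable {m l : Type*} [Fintype m] [DecidableEq m] [Fintype l] [DecidableEq l] {q : ℝ}

theorem Matrix.IsHermitian.eigPowSum_eq {A : Matrix m m ℂ} (hA : A.IsHermitian) :
    eigPowSum q A = ∑ i, hA.eigenvalues i ^ q := by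
  unfold eigPowSum
  rw [hA.roots_charpoly_eq_eigenvalues, Multiset.map_map]
  simp only [Function.comp_def, Finset.sum]
  rfl

theorem Matrix.IsHermitian.eigPowSum_eq_eigenvalues₀ {A : Matrix m m ℂ} (hA : A.IsHermitian) :
    eigPowSum q A = ∑ i, hA.eigenvalues₀ i ^ q := by
  unfold eigPowSum
  rw [hA.roots_charpoly_eq_eigenvalues₀, Multiset.map_map]
  simp only [Function.comp_def, Finset.sum]
  rfl

theorem eigPowSum_mul_comm (A B : Matrix m m ℂ) : eigPowSum q (A * B) = eigPowSum q (B * A) := by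
  rw [eigPowSum, Matrix.charpoly_mul_comm, eigPowSum]

theorem eigPowSum_conj {U V : Matrix m m ℂ} (h : U * V = 1) (A : Matrix m m ℂ) :
    eigPowSum q (V * A * U) = eigPowSum q A := by
  rw [eigPowSum_mul_comm, ← mul_assoc, h, one_mul]

theorem eigPowSum_diagonal (d : m → ℂ) :
    eigPowSum q (diagonal d) = ∑ i, (d i).re ^ q := by
  unfold eigPowSum
  rw [charpoly_diagonal, Polynomial.roots_prod _ _
    (Finset.prod_ne_zero_iff.2 fun i _ => Polynomial.X_sub_C_ne_zero _)]
  simp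

theorem eigPowSum_zero (hq : q ≠ 0) : eigPowSum q (0 : Matrix m m ℂ) = 0 := by
  rw [← diagonal_zero, eigPowSum_diagonal]
  simp [Real.zero_rpow hq]

theorem eigPowSum_fromBlocks (A : Matrix m m ℂ) (D : Matrix l l ℂ) :
    eigPowSum q (fromBlocks A 0 0 D) = eigPowSum q A + eigPowSum q D := by
  unfold eigPowSum
  rw [charpoly_fromBlocks_zero₁₂, Polynomial.roots_mul
    (mul_ne_zero (charpoly_monic A).ne_zero (charpoly_monic D).ne_zero)]
  simp

theorem Matrix.PosSemidef.eigPowSum_nonneg {A : Matrix m m ℂ} (hA : A.PosSemidef) :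
    0 ≤ eigPowSum q A := by
  rw [hA.isHermitian.eigPowSum_eq]
  exact Finset.sum_nonneg fun i _ => Real.rpow_nonneg (hA.eigenvalues_nonneg i) _

theorem Matrix.PosSemidef.eigPowSum_smul {A : Matrix m m ℂ} (hA : A.PosSemidef) {r : ℝ}
    (hr : 0 ≤ r) : eigPowSum q ((r : ℂ) • A) = r ^ q * eigPowSum q A := by
  have hU := Unitary.coe_star_mul_self hA.isHermitian.eigenvectorUnitary
  have h := hA.isHermitian.spectral_theorem
  rw [Unitary.conjStarAlgAut_apply] at h
  rw [hA.isHermitian.eigPowSum_eq]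
  conv_lhs => rw [h]
  rw [← smul_mul_assoc, ← mul_smul_comm, eigPowSum_conj hU, ← diagonal_smul, eigPowSum_diagonal,
    Finset.mul_sum]
  refine Finset.sum_congr rfl fun i _ => ?_
  simp [Real.mul_rpow hr (hA.eigenvalues_nonneg i)]

/-- The sum of the `q`-th powers of the diagonal entries of a positive semidefinite matrix is at
most the sum of the `q`-th powers of its eigenvalues. -/
theorem Matrix.PosSemidef.sum_diag_rpow_le {A : Matrix m m ℂ} (hA : A.PosSemidef) (hq : 1 ≤ q) :
    ∑ k, (A k k).re ^ q ≤ eigPowSum q A := by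
  set U : Matrix m m ℂ := hA.isHermitian.eigenvectorUnitary.1 with hUdef
  have hU₁ : star U * U = 1 := Unitary.coe_star_mul_self _
  have hU₂ : U * star U = 1 := Unitary.coe_mul_star_self _
  have h := hA.isHermitian.spectral_theorem
  rw [Unitary.conjStarAlgAut_apply] at h
  -- The weights `|U k j|²` are doubly stochastic: row sums allow Jensen in each `k`, column sums
  -- collapse the total.
  have hdiag (k : m) : (A k k).re =
      ∑ j, Complex.normSq (U k j) * hA.isHermitian.eigenvalues j := by
    conv_lhs => rw [h]
    rw [Matrix.mul_apply, Complex.re_sum]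
    refine Finset.sum_congr rfl fun j _ => ?_
    rw [← hUdef, mul_diagonal, star_eq_conjTranspose, conjTranspose_apply, mul_right_comm,
      Complex.star_def, Complex.mul_conj]
    simp
  have hrow (k : m) : ∑ j, Complex.normSq (U k j) = 1 := by
    have := congrArg Complex.re (congrFun (congrFun hU₂ k) k)
    simpa [Matrix.mul_apply, star_eq_conjTranspose, Complex.mul_conj, Complex.normSq_apply]
      using this
  have hcol (j : m) : ∑ k, Complex.normSq (U k j) = 1 := by
    have := congrArg Complex.re (congrFun (congrFun hU₁ j) j)
    simpa [Matrix.mul_apply, star_eq_conjTranspose, Complex.normSq_apply] using this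
  calc ∑ k, (A k k).re ^ q
      ≤ ∑ k, ∑ j, Complex.normSq (U k j) * hA.isHermitian.eigenvalues j ^ q := by
        refine Finset.sum_le_sum fun k _ => ?_
        rw [hdiag]
        exact Real.rpow_arith_mean_le_arith_mean_rpow _ _ _
          (fun _ _ => Complex.normSq_nonneg _) (hrow k) (fun j _ => hA.eigenvalues_nonneg j) hq
    _ = eigPowSum q A := by
        rw [Finset.sum_comm, hA.isHermitian.eigPowSum_eq]
        simp_rw [← Finset.sum_mul, hcol, one_mul]

theorem Real.add_rpow_le_two_rpow_mul {x y : ℝ} (hx : 0 ≤ x) (hy : 0 ≤ y) (hq : 1 ≤ q) :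
    (x + y) ^ q ≤ 2 ^ (q - 1) * (x ^ q + y ^ q) := by
  lift x to NNReal using hx
  lift y to NNReal using hy
  exact_mod_cast NNReal.rpow_add_le_mul_rpow_add_rpow x y hq

/-- In an eigenbasis of `A + B` each eigenvalue is a sum of diagonal entries of the two summands, so
scalar convexity of `x ^ q` suffices, followed by `sum_diag_rpow_le` for each summand. -/
theorem Matrix.PosSemidef.eigPowSum_add_le {A B : Matrix m m ℂ} (hA : A.PosSemidef)
    (hB : B.PosSemidef) (hq : 1 ≤ q) :
    eigPowSum q (A + B) ≤ 2 ^ (q - 1) * (eigPowSum q A + eigPowSum q B) := by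
  have hAB := (hA.add hB).isHermitian
  set U : Matrix m m ℂ := hAB.eigenvectorUnitary.1 with hUdef
  have hU : U * star U = 1 := Unitary.coe_mul_star_self _
  have h := hAB.conjStarAlgAut_star_eigenvectorUnitary
  rw [Unitary.conjStarAlgAut_star_apply, ← hUdef, mul_add, add_mul] at h
  have hA' : (star U * A * U).PosSemidef := hA.conjTranspose_mul_mul_same U
  have hB' : (star U * B * U).PosSemidef := hB.conjTranspose_mul_mul_same U
  have hA'' := hA'.sum_diag_rpow_le hq
  have hB'' := hB'.sum_diag_rpow_le hq
  rw [eigPowSum_conj hU] at hA'' hB''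
  have hdiag (k : m) :
      hAB.eigenvalues k = ((star U * A * U) k k).re + ((star U * B * U) k k).re := by
    have := congrArg Complex.re (congrFun (congrFun h k) k)
    simpa using this.symm
  calc eigPowSum q (A + B) = ∑ k, hAB.eigenvalues k ^ q := hAB.eigPowSum_eq
    _ ≤ ∑ k, 2 ^ (q - 1) * (((star U * A * U) k k).re ^ q + ((star U * B * U) k k).re ^ q) := by
        refine Finset.sum_le_sum fun k _ => ?_
        rw [hdiag]
        exact Real.add_rpow_le_two_rpow_mul (Complex.le_def.1 hA'.diag_nonneg).1
          (Complex.le_def.1 hB'.diag_nonneg).1 hq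
    _ = 2 ^ (q - 1) * (∑ k, ((star U * A * U) k k).re ^ q +
          ∑ k, ((star U * B * U) k k).re ^ q) := by
        rw [← Finset.mul_sum, Finset.sum_add_distrib]
    _ ≤ _ := by gcongr

end EigPowSum

/-! ### Schatten norms of block matrices. -/

section SchattenNorm

variable {m l : Type*} [Fintype m] [DecidableEq m] [Fintype l] [DecidableEq l] {p : ℝ}

theorem sum_singularValues_rpow (A : Matrix m m ℂ) :
    ∑ j ∈ Finset.range (Fintype.card m), (Matrix.toEuclideanLin A).singularValues j ^ p =
      eigPowSum (p / 2) (Aᴴ * A) := by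
  have hT : LinearMap.adjoint (toEuclideanLin A) ∘ₗ toEuclideanLin A = toEuclideanLin (Aᴴ * A) := by
    rw [← Matrix.toEuclideanLin_conjTranspose_eq_adjoint]
    ext x i
    simp [Matrix.toLpLin_apply, Matrix.mulVec_mulVec]
  have hev (i : Fin (Fintype.card m)) :
      (toEuclideanLin A).isSymmetric_adjoint_comp_self.eigenvalues finrank_euclideanSpace i =
        (isHermitian_conjTranspose_mul_self A).eigenvalues₀ i := by
    unfold Matrix.IsHermitian.eigenvalues₀
    congr 1
  rw [(isHermitian_conjTranspose_mul_self A).eigPowSum_eq_eigenvalues₀, Finset.sum_range]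
  refine Finset.sum_congr rfl fun i _ => ?_
  rw [← hev, ← LinearMap.sq_singularValues_fin, ← Real.rpow_natCast,
    ← Real.rpow_mul (LinearMap.singularValues_nonneg _ _)]
  congr 1
  push_cast
  ring

theorem schattenNorm_nonneg (A : Matrix m m ℂ) : 0 ≤ schattenNorm p A :=
  Real.rpow_nonneg (Finset.sum_nonneg fun _ _ =>
    Real.rpow_nonneg (LinearMap.singularValues_nonneg _ _) _) _

theorem schattenNorm_rpow (hp : 0 < p) (A : Matrix m m ℂ) :
    schattenNorm p A ^ p = eigPowSum (p / 2) (Aᴴ * A) := by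
  rw [schattenNorm, sum_singularValues_rpow, ← Real.rpow_mul
    (posSemidef_conjTranspose_mul_self A).eigPowSum_nonneg, one_div_mul_cancel hp.ne', Real.rpow_one]

theorem schattenNorm_conjTranspose (A : Matrix m m ℂ) : schattenNorm p Aᴴ = schattenNorm p A := by
  rw [schattenNorm, sum_singularValues_rpow, conjTranspose_conjTranspose, eigPowSum_mul_comm,
    ← sum_singularValues_rpow, schattenNorm]

theorem schattenNorm_smul_rpow (hp : 0 < p) (c : ℂ) (A : Matrix m m ℂ) :
    schattenNorm p (c • A) ^ p = ‖c‖ ^ p * schattenNorm p A ^ p := by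
  have hc : (c • A)ᴴ * (c • A) = ((‖c‖ ^ 2 : ℝ) : ℂ) • (Aᴴ * A) := by
    rw [conjTranspose_smul, smul_mul_assoc, mul_smul_comm, smul_smul, Complex.star_def,
      Complex.conj_mul']
    push_cast
    rfl
  rw [schattenNorm_rpow hp, schattenNorm_rpow hp, hc,
    (posSemidef_conjTranspose_mul_self A).eigPowSum_smul (by positivity), ← Real.rpow_natCast,
    ← Real.rpow_mul (norm_nonneg _)]
  congr 2
  push_cast
  ring

theorem schattenNorm_fromBlocks_diagonal_rpow (hp : 0 < p) (A : Matrix m m ℂ) (D : Matrix l l ℂ) :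
    schattenNorm p (fromBlocks A 0 0 D) ^ p = schattenNorm p A ^ p + schattenNorm p D ^ p := by
  rw [schattenNorm_rpow hp, schattenNorm_rpow hp, schattenNorm_rpow hp, ← eigPowSum_fromBlocks]
  simp [fromBlocks_conjTranspose, fromBlocks_multiply]

/-- A Schatten norm inequality of Clarkson type for a block matrix with one vanishing block. -/
theorem schattenNorm_fromBlocks_rpow_le (hp : 2 ≤ p) (H K L : Matrix m m ℂ) :
    schattenNorm p (fromBlocks H K L 0) ^ p ≤
      2 ^ (p - 2) * (schattenNorm p H ^ p + schattenNorm p K ^ p + schattenNorm p L ^ p) := by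
  have hp0 : 0 < p := by linarith
  have hq : 1 ≤ p / 2 := by linarith
  have hq0 : p / 2 ≠ 0 := by linarith
  -- Splitting by block columns kills the cross terms in `M * Mᴴ`; swapping the factors afterwards
  -- leaves a single nonzero block in each of `Xᴴ * X` and `Yᴴ * Y`.
  set X : Matrix (m ⊕ m) (m ⊕ m) ℂ := fromBlocks H 0 L 0
  set Y : Matrix (m ⊕ m) (m ⊕ m) ℂ := fromBlocks 0 K 0 0
  have hM : fromBlocks H K L 0 * (fromBlocks H K L 0)ᴴ = X * Xᴴ + Y * Yᴴ := by
    simp [X, Y, fromBlocks_conjTranspose, fromBlocks_multiply, fromBlocks_add]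
  have hX : Xᴴ * X = fromBlocks (Hᴴ * H + Lᴴ * L) 0 0 0 := by
    simp [X, fromBlocks_conjTranspose, fromBlocks_multiply]
  have hY : Yᴴ * Y = fromBlocks 0 0 0 (Kᴴ * K) := by
    simp [Y, fromBlocks_conjTranspose, fromBlocks_multiply]
  have h₁ := (posSemidef_self_mul_conjTranspose X).eigPowSum_add_le
    (posSemidef_self_mul_conjTranspose Y) hq
  rw [← hM, eigPowSum_mul_comm, eigPowSum_mul_comm X, eigPowSum_mul_comm Y, hX, hY,
    eigPowSum_fromBlocks, eigPowSum_fromBlocks, eigPowSum_zero hq0] at h₁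
  have h₂ := (posSemidef_conjTranspose_mul_self H).eigPowSum_add_le
    (posSemidef_conjTranspose_mul_self L) hq
  simp only [← schattenNorm_rpow hp0] at h₁ h₂
  -- `K` picks up the convexity constant only once, `H` and `L` twice; as the constant is at least
  -- 1, the `K` term can be padded.
  have h2 : (1 : ℝ) ≤ 2 ^ (p / 2 - 1) := Real.one_le_rpow (by norm_num) (by linarith)
  have h2' : (2 : ℝ) ^ (p - 2) = 2 ^ (p / 2 - 1) * 2 ^ (p / 2 - 1) := by
    rw [← Real.rpow_add (by norm_num)]
    congr 1
    ring
  have hK : 0 ≤ schattenNorm p K ^ p := Real.rpow_nonneg (schattenNorm_nonneg _) _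
  calc _ ≤ _ := h₁
    _ ≤ 2 ^ (p / 2 - 1) * (2 ^ (p / 2 - 1) * (schattenNorm p H ^ p + schattenNorm p L ^ p) +
          2 ^ (p / 2 - 1) * schattenNorm p K ^ p) := by
        gcongr
        · linarith
        · linarith [le_mul_of_one_le_left hK h2]
    _ = _ := by rw [h2']; ring

end SchattenNorm

/-! ### Generalized numerical radii. -/

section NumericalRadius

variable {m l : Type*} [Fintype m] [DecidableEq m] [Fintype l] [DecidableEq l] {p : ℝ}

theorem rotatedRealPart_fromBlocks (A : Matrix m m ℂ) (B : Matrix m l ℂ) (C : Matrix l m ℂ)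
    (D : Matrix l l ℂ) (θ : ℝ) :
    rotatedRealPart (fromBlocks A B C D) θ = fromBlocks (rotatedRealPart A θ)
      ((1 / 2 : ℂ) • (Complex.exp (θ * Complex.I) • B + (Complex.exp (θ * Complex.I) • C)ᴴ))
      ((1 / 2 : ℂ) • (Complex.exp (θ * Complex.I) • C + (Complex.exp (θ * Complex.I) • B)ᴴ))
      (rotatedRealPart D θ) := by
  simp only [rotatedRealPart, fromBlocks_smul, fromBlocks_conjTranspose, fromBlocks_add]

theorem Matrix.IsHermitian.rotatedRealPart_eq {A : Matrix m m ℂ} (hA : A.IsHermitian) (θ : ℝ) :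
    rotatedRealPart A θ = (Real.cos θ : ℂ) • A := by
  rw [rotatedRealPart, conjTranspose_smul, hA.eq, ← add_smul, smul_smul, Complex.star_def,
    ← Complex.exp_conj, map_mul, Complex.conj_ofReal, Complex.conj_I, Complex.ofReal_cos,
    Complex.cos]
  congr 1
  rw [mul_neg, neg_mul]
  ring

theorem schattenNorm_rotatedRealPart_le (hp : 0 < p) (A : Matrix m m ℂ) (θ : ℝ) :
    schattenNorm p (rotatedRealPart A θ) ≤ schattenNumericalRadius p A :=
  le_ciSup (bddAbove_schattenNorm_rotatedRealPart p hp A) θ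

theorem schattenNumericalRadius_nonneg (A : Matrix m m ℂ) : 0 ≤ schattenNumericalRadius p A :=
  Real.iSup_nonneg fun _ => schattenNorm_nonneg _

theorem schattenNorm_rotatedRealPart_rpow_le (hp : 0 < p) (A : Matrix m m ℂ) (θ : ℝ) :
    schattenNorm p (rotatedRealPart A θ) ^ p ≤ schattenNumericalRadius p A ^ p :=
  Real.rpow_le_rpow (schattenNorm_nonneg _) (schattenNorm_rotatedRealPart_le hp A θ) hp.le

theorem schattenNumericalRadius_le_of_rpow_le (hp : 0 < p) {A : Matrix m m ℂ} {c : ℝ}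
    (h : ∀ θ, schattenNorm p (rotatedRealPart A θ) ^ p ≤ c) :
    schattenNumericalRadius p A ≤ c ^ (1 / p) := by
  refine ciSup_le fun θ => ?_
  rw [one_div, Real.le_rpow_inv_iff_of_pos (schattenNorm_nonneg _)
    ((Real.rpow_nonneg (schattenNorm_nonneg _) _).trans (h θ)) hp]
  exact h θ

/-- Rotation only scales a Hermitian matrix by `cos θ`, so the supremum is attained at `θ = 0`. -/
theorem Matrix.IsHermitian.schattenNumericalRadius_eq (hp : 0 < p) {A : Matrix m m ℂ}
    (hA : A.IsHermitian) : schattenNumericalRadius p A = schattenNorm p A := by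
  apply le_antisymm
  · refine ciSup_le fun θ => ?_
    rw [← Real.rpow_le_rpow_iff (schattenNorm_nonneg _) (schattenNorm_nonneg _) hp,
      hA.rotatedRealPart_eq, schattenNorm_smul_rpow hp]
    refine mul_le_of_le_one_left (Real.rpow_nonneg (schattenNorm_nonneg _) _)
      (Real.rpow_le_one (norm_nonneg _) ?_ hp.le)
    rw [Complex.norm_real]
    exact Real.abs_cos_le_one θ
  · simpa [hA.rotatedRealPart_eq] using schattenNorm_rotatedRealPart_le hp A 0

theorem schattenNumericalRadius_fromBlocks_diagonal_le (hp : 0 < p) (A : Matrix m m ℂ)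
    (D : Matrix l l ℂ) :
    schattenNumericalRadius p (fromBlocks A 0 0 D) ≤
      (schattenNumericalRadius p A ^ p + schattenNumericalRadius p D ^ p) ^ (1 / p) := by
  refine schattenNumericalRadius_le_of_rpow_le hp fun θ => ?_
  rw [rotatedRealPart_fromBlocks]
  simp only [smul_zero, conjTranspose_zero, add_zero]
  rw [schattenNorm_fromBlocks_diagonal_rpow hp]
  exact add_le_add (schattenNorm_rotatedRealPart_rpow_le hp A θ)
    (schattenNorm_rotatedRealPart_rpow_le hp D θ)

theorem schattenNumericalRadius_fromBlocks_row_le (hp : 2 ≤ p) (A B : Matrix m m ℂ) :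
    schattenNumericalRadius p (fromBlocks A B 0 0) ≤
      (2 ^ (p - 2) * (schattenNumericalRadius p A ^ p +
        1 / (2 : ℝ) ^ (p - 1) * schattenNorm p B ^ p)) ^ (1 / p) := by
  have hp0 : 0 < p := by linarith
  refine schattenNumericalRadius_le_of_rpow_le hp0 fun θ => ?_
  set c : ℂ := (1 / 2 : ℂ) * Complex.exp (θ * Complex.I)
  have hc : ‖c‖ = 1 / 2 := by
    rw [norm_mul, Complex.norm_exp_ofReal_mul_I]
    norm_num
  have hrot : rotatedRealPart (fromBlocks A B 0 0) θ =
      fromBlocks (rotatedRealPart A θ) (c • B) (c • B)ᴴ 0 := by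
    rw [rotatedRealPart_fromBlocks]
    simp [rotatedRealPart, c, smul_smul, mul_comm]
  -- The two off-diagonal blocks `c • B` and its adjoint each contribute `(1/2)^p ‖B‖_p^p`.
  have hcp : 1 / (2 : ℝ) ^ (p - 1) = (1 / 2) ^ p + (1 / 2) ^ p := by
    rw [Real.rpow_sub (by norm_num), Real.rpow_one, Real.div_rpow (by norm_num) (by norm_num),
      Real.one_rpow]
    field_simp
    norm_num
  rw [hrot]
  refine (schattenNorm_fromBlocks_rpow_le hp _ _ _).trans ?_
  rw [schattenNorm_conjTranspose, schattenNorm_smul_rpow hp0, hc, hcp, add_assoc, ← add_mul]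
  gcongr 2 ^ (p - 2) * (?_ + _)
  exact schattenNorm_rotatedRealPart_rpow_le hp0 A θ

end NumericalRadius

theorem corollary4p4 (n : ℕ) (p : ℝ) (hp : 2 ≤ p) (A B D : Matrix (Fin n) (Fin n) ℂ) :
    schattenNumericalRadius p (Matrix.fromBlocks A 0 0 D) ≤
        1 / (2 : ℝ) ^ (2 / p - 1) *
          (schattenNumericalRadius p A ^ p + schattenNumericalRadius p D ^ p) ^ (1 / p) ∧
    (A.IsHermitian → D.IsHermitian →
      schattenNumericalRadius p (Matrix.fromBlocks A 0 0 D) =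
        (schattenNumericalRadius p A ^ p + schattenNumericalRadius p D ^ p) ^ (1 / p)) ∧
    schattenNumericalRadius p (Matrix.fromBlocks A B 0 0) ≤
        1 / (2 : ℝ) ^ (2 / p - 1) *
          (schattenNumericalRadius p A ^ p +
            1 / (2 : ℝ) ^ (p - 1) * schattenNorm p B ^ p) ^ (1 / p) := by
  have hp0 : 0 < p := by linarith
  have hA := Real.rpow_nonneg (schattenNumericalRadius_nonneg (p := p) A) p
  have hD := Real.rpow_nonneg (schattenNumericalRadius_nonneg (p := p) D) p
  have hB := Real.rpow_nonneg (schattenNorm_nonneg (p := p) B) p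
  have hconst : 1 / (2 : ℝ) ^ (2 / p - 1) = (2 ^ (p - 2)) ^ (1 / p) := by
    rw [← Real.rpow_mul (by norm_num), one_div, ← Real.rpow_neg (by norm_num)]
    congr 1
    field_simp
    ring
  refine ⟨?_, fun hAh hDh => ?_, ?_⟩
  -- Since `p ≥ 2`, the stated constant only weakens the bound with constant 1.
  · have h₁ : 1 ≤ 1 / (2 : ℝ) ^ (2 / p - 1) := by
      rw [hconst]
      exact Real.one_le_rpow (Real.one_le_rpow (by norm_num) (by linarith)) (one_div_nonneg.2 hp0.le)
    have h₂ := Real.rpow_nonneg (add_nonneg hA hD) (1 / p)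
    exact (schattenNumericalRadius_fromBlocks_diagonal_le hp0 A D).trans
      (le_mul_of_one_le_left h₂ h₁)
  · have hM : (fromBlocks A 0 0 D).IsHermitian := hAh.fromBlocks (by simp) hDh
    rw [IsHermitian.schattenNumericalRadius_eq hp0 hM,
      IsHermitian.schattenNumericalRadius_eq hp0 hAh,
      IsHermitian.schattenNumericalRadius_eq hp0 hDh, ← schattenNorm_fromBlocks_diagonal_rpow hp0, one_div,
      Real.rpow_rpow_inv (schattenNorm_nonneg _) hp0.ne']
  · rw [hconst, ← Real.mul_rpow (Real.rpow_nonneg zero_le_two _)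
      (add_nonneg hA (mul_nonneg (one_div_nonneg.2 (Real.rpow_nonneg zero_le_two _)) hB))]
    exact schattenNumericalRadius_fromBlocks_row_le hp A B
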